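/- Let $K$ be a countably infinite field with $\operatorname{char}K\neq 2$ and let $F_2$ be the free group on two generators. A representation $(V,G)$ is a $K$-module $V$ together with a right action $\circ$ of the group $G$ by $K$-linear maps. A homomorphism $(\alpha,\beta):(V,G)\to(W,H)$ consists of a $K$-linear map $\alpha:V\to W$ and a group homomorphism $\beta:G\to H$ with $(v\circ g)^\alpha=v^\alpha\circ g^\beta$ for all $v\in V$, $g\in G$. For finite sets $X,Y$, let $F(Y)$ be the free group on $Y$, let $XKF(Y)$ be the free right $KF(Y)$-module with basis $X$, and let $W(X,Y)=(XKF(Y),F(Y))$. For $T\subseteq XKF(Y)$, the action type $(V,G)$-closure $T^{\nabla\nabla}_{(V,G)}$ is the set of all $w\in XKF(Y)$ such that $w^\alpha=0$ for every homomorphism $(\alpha,\beta):W(X,Y)\to(V,G)$ with $T\subseteq\ker\alpha$. Two representations are action type geometrically equivalent if they give the same closure of every $T\subseteq XKF(Y)$, for all finite $X,Y$. The representation $(V,G)$ is action type logically Noetherian if for all finite $X,Y$, all $T\subseteq XKF(Y)$ and all $w\in T^{\nabla\nabla}_{(V,G)}$ there is a finite $T_0\subseteq T$ with $w\in (T_0)^{\nabla\nabla}_{(V,G)}$.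 It satisfies the action type quasi-identity $(w_1=0\wedge\dots\wedge w_n=0)\Rightarrow w_0=0$, where $w_0,\dots,w_n\in XKF(Y)$, if $w_0^\alpha=0$ for every homomorphism $(\alpha,\beta):W(X,Y)\to(V,G)$ with $w_1^\alpha=\dots=w_n^\alpha=0$. If $\mathfrak U$ is an ultrafilter on a set $I$, the ultrapower of $(V,G)$ by $\mathfrak U$ is the representation $(V^I/\mathfrak U,\;G^I/\mathfrak U)$ with action $[v]\circ[g]=[(v_i\circ g_i)_{i\in I}]$. Let $\{V_j\mid j\in J\}$ be the set of all finitely generated right ideals of the group ring $KF_2$, and let $V=\prod_{j\in J}KF_2/V_j$ be the Cartesian product, a right $KF_2$-module, which gives the representation $(V,F_2)$. Then $(V,F_2)$ is not action type logically Noetherian, and there exists an ultrapower $(\widetilde V,\widetilde{F_2})$ of $(V,F_2)$ that is not action type geometrically equivalent to $(V,F_2)$, although $(\widetilde V,\widetilde{F_2})$ and $(V,F_2)$ satisfy the same action type quasi-identities. -/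

import Mathlib

open Filter MulOpposite
open scoped MonoidAlgebra

/-!
Representations `(V, G)` of groups over a commutative ring `K` act from the right.  A right
action of `G` on the `K`-module `V` by `K`-linear maps is Mathlib's `Representation K Gᵐᵒᵖ V`,
where `v ∘ g` is `ρ (op g) v`.  Right modules over a ring `R` are modules over `Rᵐᵒᵖ`.
-/

namespace ActionType

noncomputable section

/-- The right action of `G` on the `K`-module `V`, written `v ∘ g` in mathematics. -/
abbrev RightRep (K G V : Type*) [CommRing K] [Group G] [AddCommGroup V] [Module K V] :=
  Representation K Gᵐᵒᵖ V

/-- The representation `(M, G)` given by a right `KG`-module `M`: `v ∘ g = v g`. -/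
def ofRightModule (K G M : Type*) [CommRing K] [Group G] [AddCommGroup M] [Module K M]
    [Module (K[G])ᵐᵒᵖ M] [IsScalarTower K (K[G])ᵐᵒᵖ M] : RightRep K G M :=
  ((Algebra.lsmul K K M : (K[G])ᵐᵒᵖ →ₐ[K] Module.End K M) : (K[G])ᵐᵒᵖ →* Module.End K M).comp
    (MonoidHom.op (MonoidAlgebra.of K G))

theorem ofRightModule_apply {K G M : Type*} [CommRing K] [Group G] [AddCommGroup M] [Module K M]
    [Module (K[G])ᵐᵒᵖ M] [IsScalarTower K (K[G])ᵐᵒᵖ M] (g : G) (v : M) :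
    ofRightModule K G M (op g) v = op (MonoidAlgebra.of K G g) • v := rfl

/-- A homomorphism `(α, β) : (V, G) → (W, H)` of representations. -/
structure RepHom {K G H V W : Type*} [CommRing K] [Group G] [Group H] [AddCommGroup V]
    [Module K V] [AddCommGroup W] [Module K W] (ρ : RightRep K G V) (σ : RightRep K H W) where
  /-- the homomorphism of `K`-modules -/
  α : V →ₗ[K] W
  /-- the homomorphism of groups -/
  β : G →* H
  /-- `(v ∘ g)^α = v^α ∘ g^β` -/
  map_act : ∀ (v : V) (g : G), α (ρ (op g) v) = σ (op (β g)) (α v)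

/-- The free right `KF(Y)`-module `XKF(Y) = ⨁_{x ∈ X} x KF(Y)` with basis `X`. -/
abbrev FreeMod (K X Y : Type*) [CommRing K] : Type _ := X →₀ K[FreeGroup Y]

/-- The free representation `W(X, Y) = (XKF(Y), F(Y))`. -/
def freeRep (K X Y : Type*) [CommRing K] : RightRep K (FreeGroup Y) (FreeMod K X Y) :=
  ofRightModule K (FreeGroup Y) (FreeMod K X Y)

section Geometry

variable {K G V : Type*} [CommRing K] [Group G] [AddCommGroup V] [Module K V]

/-- The algebraic set in the affine space `Hom(W(X, Y), (V, G))` defined by the system `T` of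
action type equations: the points `(α, β)` with `T ⊆ ker α`. -/
def algSet (ρ : RightRep K G V) {X Y : Type*} (T : Set (FreeMod K X Y)) :
    Set (RepHom (freeRep K X Y) ρ) :=
  {p | ∀ w ∈ T, p.α w = 0}

/-- The action type equations satisfied at all points of `A`: the intersection of the `ker α`. -/
def eqnsOf (ρ : RightRep K G V) {X Y : Type*} (A : Set (RepHom (freeRep K X Y) ρ)) :
    Set (FreeMod K X Y) :=
  {w | ∀ p ∈ A, p.α w = 0}

/-- The action type `(V, G)`-closure of a set `T` of action type equations. -/
def atClosure (ρ : RightRep K G V) {X Y : Type*} (T : Set (FreeMod K X Y)) :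
    Set (FreeMod K X Y) :=
  eqnsOf ρ (algSet ρ T)

/-- Action type geometrical equivalence: equal closures of all `T ⊆ XKF(Y)`, for all finite `X`
and `Y` (taken, up to bijection, to be `Fin m` and `Fin n`). -/
def GeomEquiv (ρ : RightRep K G V) {G' V' : Type*} [Group G'] [AddCommGroup V'] [Module K V']
    (ρ' : RightRep K G' V') : Prop :=
  ∀ (m n : ℕ) (T : Set (FreeMod K (Fin m) (Fin n))), atClosure ρ T = atClosure ρ' T

/-- Action type logically Noetherian representations. -/
def LogicallyNoetherian (ρ : RightRep K G V) : Prop :=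
  ∀ (m n : ℕ) (T : Set (FreeMod K (Fin m) (Fin n))), ∀ w ∈ atClosure ρ T,
    ∃ T₀ : Set (FreeMod K (Fin m) (Fin n)), T₀ ⊆ T ∧ T₀.Finite ∧ w ∈ atClosure ρ T₀

variable (K) in
/-- An action type quasi-identity `(w₁ = 0 ∧ ⋯ ∧ w_k = 0) ⇒ w₀ = 0` with all `wᵢ` in `XKF(Y)`,
`X` and `Y` finite. -/
structure QuasiIdentity where
  /-- the number of generators in `X` -/
  m : ℕ
  /-- the number of generators in `Y` -/
  n : ℕ
  /-- the number of premises -/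
  k : ℕ
  /-- the left-hand sides of the premises -/
  premise : Fin k → FreeMod K (Fin m) (Fin n)
  /-- the left-hand side of the conclusion -/
  conclusion : FreeMod K (Fin m) (Fin n)

/-- `(V, G) ⊨ q`. -/
def Satisfies (ρ : RightRep K G V) (q : QuasiIdentity K) : Prop :=
  ∀ p : RepHom (freeRep K (Fin q.m) (Fin q.n)) ρ,
    (∀ i, p.α (q.premise i) = 0) → p.α q.conclusion = 0

/-- The set of all action type quasi-identities satisfied by `(V, G)`. -/
def qId (ρ : RightRep K G V) : Set (QuasiIdentity K) := {q | Satisfies ρ q}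

/-- The ultrapower of `(V, G)` by an ultrafilter `U` on `I`: the ultrapowers of `V` and of `G`
(`I → V` and `I → G` modulo equality `U`-almost everywhere, which are Mathlib's germs along `U`),
with `[v] ∘ [g] = [i ↦ v i ∘ g i]`. -/
def ultrapower (ρ : RightRep K G V) {I : Type*} (U : Ultrafilter I) :
    RightRep K (Germ (U : Filter I) G) (Germ (U : Filter I) V) where
  toFun g :=
    { toFun := fun v => Germ.map₂ (fun (a : G) (x : V) => ρ (op a) x) g.unop v
      map_add' := fun v w => by
        induction g using MulOpposite.rec' with | _ g =>
        induction g using Germ.inductionOn with | _ g =>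
        induction v, w using Germ.inductionOn₂ with | _ v w =>
        exact congrArg (fun f : I → V => (f : Germ (U : Filter I) V))
          (funext fun i => map_add (ρ (op (g i))) (v i) (w i))
      map_smul' := fun c v => by
        induction g using MulOpposite.rec' with | _ g =>
        induction g using Germ.inductionOn with | _ g =>
        induction v using Germ.inductionOn with | _ v =>
        exact congrArg (fun f : I → V => (f : Germ (U : Filter I) V))
          (funext fun i => map_smul (ρ (op (g i))) c (v i)) }
  map_one' := by
    ext v
    induction v using Germ.inductionOn with | _ v =>
    exact congrArg (fun f : I → V => (f : Germ (U : Filter I) V))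
      (funext fun i => by simp)
  map_mul' g h := by
    ext v
    induction g using MulOpposite.rec' with | _ g =>
    induction h using MulOpposite.rec' with | _ h =>
    induction g, h using Germ.inductionOn₂ with | _ g h =>
    induction v using Germ.inductionOn with | _ v =>
    exact congrArg (fun f : I → V => (f : Germ (U : Filter I) V))
      (funext fun i => by simp)

theorem ultrapower_apply (ρ : RightRep K G V) {I : Type*} (U : Ultrafilter I)
    (g : I → G) (v : I → V) :
    ultrapower ρ U (op (g : Germ (U : Filter I) G)) (v : Germ (U : Filter I) V) =
      ((fun i => ρ (op (g i)) (v i) : I → V) : Germ (U : Filter I) V) := rfl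

end Geometry

section Example

variable (K : Type*) [Field K]

/-- The free group with two generators. -/
abbrev F₂ : Type := FreeGroup (Fin 2)

/-- The set `J` of all finitely generated right ideals of `KF₂`. -/
abbrev FGRightIdeal : Type _ :=
  {U : Submodule (K[F₂])ᵐᵒᵖ K[F₂] // U.FG}

/-- The right `KF₂`-module `V`, the Cartesian product of the `KF₂ / U` over all finitely
generated right ideals `U`. -/
abbrev bigModule : Type _ := ∀ U : FGRightIdeal K, K[F₂] ⧸ U.1

/-- The representation `(V, F₂)`. -/
def bigRep : RightRep K F₂ (bigModule K) := ofRightModule K F₂ (bigModule K)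

theorem bigRep_apply (v : FGRightIdeal K → K[F₂]) (g : F₂) :
    bigRep K (op g) (fun U => Submodule.Quotient.mk (v U)) =
      fun U => Submodule.Quotient.mk (v U * MonoidAlgebra.of K F₂ g) := rfl

end Example

end

end ActionType

/-!
The argument compares an uncountable family of systems with the countable supply of data that
points of `(V, F₂)` can distinguish.

Let `a`, `b` be the generators of `F₂`.  For `S ⊆ ℤ` consider the system `T_S` of the equations
`x (bⁱ a b⁻ⁱ - ε_S(i)) = 0`, `i ∈ ℤ`, in one module variable `x`, where `ε_S(i)` is `-1` on `S` and
`1` off `S`.  The right ideal generated by these elements is proper (`one_notMem_span_signRel`):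
`F₂` acts on the functions `f : ℤ → K` with `a` multiplying by `ε_S` and `b` translating, and each
`u` in the right ideal satisfies `(u f)(0) = 0` for all `f`.

* A finite subsystem `T₀` generates a finitely generated proper right ideal, so the point sending
  `x` to the class of `1` in the corresponding factor of `V` solves `T₀` but has `x ≠ 0`
  (`single_notMem_atClosure`).
* If for each `S` the system `T_S` had a solution with `x ≠ 0`, some coordinate of `x` would be a
  nonzero `c` in some `KF₂ / U` with `c β(bⁱ a b⁻ⁱ) = ε_S(i) c` for all `i`.  As `1 ≠ -1`, the triple
  `(β, U, c)` determines `S`.  But there are only countably many triples.  Hence `x` lies in the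
  closure of `T_S` for some `S` (`exists_single_mem_atClosure`).

So `(V, F₂)` is not logically Noetherian.  Points of an ultrapower are exactly the germs of families
of points (`germPoint`, `exists_eq_germPoint`).  This gives the invariance of quasi-identities
(`qId_ultrapower`), and it combines the nonzero solutions of the finite subsystems of `T_S` into a
nonzero solution of all of `T_S` in an ultrapower indexed by the finite subsets of `ℤ`
(`exists_ultrapower_notMem_atClosure`), whose closure operator is therefore different.
-/

namespace ActionType

/-! ### Points of free representations -/

section Points

variable {K G V X Y : Type*} [CommRing K] [Group G] [AddCommGroup V] [Module K V]

theorem freeRep_single (x : X) (u : K[FreeGroup Y]) (h : FreeGroup Y) :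
    freeRep K X Y (op h) (Finsupp.single x u) =
      Finsupp.single x (u * MonoidAlgebra.of K (FreeGroup Y) h) := by
  rw [freeRep, ofRightModule_apply]
  simp

theorem RepHom.α_single_of {ρ : RightRep K G V} (p : RepHom (freeRep K X Y) ρ) (x : X)
    (g : FreeGroup Y) :
    p.α (Finsupp.single x (MonoidAlgebra.of K (FreeGroup Y) g)) =
      ρ (op (p.β g)) (p.α (Finsupp.single x 1)) := by
  rw [← p.map_act, freeRep_single, one_mul]

theorem freeMod_linearMap_ext {f g : FreeMod K X Y →ₗ[K] V}
    (h : ∀ x u, f (Finsupp.single x (MonoidAlgebra.of K (FreeGroup Y) u)) =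
      g (Finsupp.single x (MonoidAlgebra.of K (FreeGroup Y) u))) : f = g := by
  refine Finsupp.lhom_ext' fun x => MonoidAlgebra.lhom_ext' fun u => LinearMap.ext_ring ?_
  simpa using h x u

theorem RepHom.ext_of_single_one {ρ : RightRep K G V} {p q : RepHom (freeRep K X Y) ρ}
    (hβ : ∀ y, p.β (FreeGroup.of y) = q.β (FreeGroup.of y))
    (hα : ∀ x, p.α (Finsupp.single x 1) = q.α (Finsupp.single x 1)) : p = q := by
  have hβ' : p.β = q.β := FreeGroup.ext_hom _ _ hβ
  have hα' : p.α = q.α := freeMod_linearMap_ext fun x u => by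
    rw [p.α_single_of, q.α_single_of, hβ', hα]
  cases p
  cases q
  cases hα'
  cases hβ'
  rfl

/-- The point of `Hom(W(X, Y), (V, G))` with prescribed images of the free generators. -/
noncomputable def pointOf (ρ : RightRep K G V) (b : Y → G) (v : X → V) :
    RepHom (freeRep K X Y) ρ where
  α := Finsupp.lsum K fun x =>
    (Finsupp.linearCombination K fun g => ρ (op (FreeGroup.lift b g)) (v x)) ∘ₗ
      (MonoidAlgebra.coeffLinearEquiv K).toLinearMap
  β := FreeGroup.lift b
  map_act w h := by
    simp only [← LinearMap.comp_apply]
    refine LinearMap.congr_fun (freeMod_linearMap_ext fun x u => ?_) w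
    simp only [LinearMap.comp_apply, freeRep_single, ← map_mul]
    simp [MonoidAlgebra.of_apply]

theorem pointOf_single_one (ρ : RightRep K G V) (b : Y → G) (v : X → V) (x : X) :
    (pointOf ρ b v).α (Finsupp.single x 1) = v x := by
  simp [pointOf, MonoidAlgebra.one_def]

end Points

/-! ### Points of ultrapowers -/

section Ultrapower

variable {K G V X Y I : Type*} [CommRing K] [Group G] [AddCommGroup V] [Module K V]
  {ρ : RightRep K G V} (U : Ultrafilter I)

/-- The point of an ultrapower given by the germ of a family of points. -/
noncomputable def germPoint (p : I → RepHom (freeRep K X Y) ρ) :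
    RepHom (freeRep K X Y) (ultrapower ρ U) where
  α :=
    { toFun := fun w => ((fun i => (p i).α w : I → V) : Germ (U : Filter I) V)
      map_add' := fun v w => congrArg (fun f : I → V => (f : Germ (U : Filter I) V))
        (funext fun i => map_add (p i).α v w)
      map_smul' := fun c w => congrArg (fun f : I → V => (f : Germ (U : Filter I) V))
        (funext fun i => map_smul (p i).α c w) }
  β :=
    { toFun := fun g => ((fun i => (p i).β g : I → G) : Germ (U : Filter I) G)
      map_one' := congrArg (fun f : I → G => (f : Germ (U : Filter I) G))
        (funext fun i => map_one (p i).β)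
      map_mul' := fun g h => congrArg (fun f : I → G => (f : Germ (U : Filter I) G))
        (funext fun i => map_mul (p i).β g h) }
  map_act w g := congrArg (fun f : I → V => (f : Germ (U : Filter I) V))
    (funext fun i => (p i).map_act w g)

theorem germPoint_α_eq_zero_iff (p : I → RepHom (freeRep K X Y) ρ) (w : FreeMod K X Y) :
    (germPoint U p).α w = 0 ↔ ∀ᶠ i in (U : Filter I), (p i).α w = 0 :=
  Germ.coe_eq

/-- Lifting the images of the free generators to families shows that every point of an ultrapower
is the germ of a family of points. -/
theorem exists_eq_germPoint (q : RepHom (freeRep K X Y) (ultrapower ρ U)) :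
    ∃ p : I → RepHom (freeRep K X Y) ρ, germPoint U p = q := by
  have hb : ∀ y, ∃ b : I → G, (b : Germ (U : Filter I) G) = q.β (FreeGroup.of y) :=
    fun y => Quotient.exists_rep _
  have hv : ∀ x, ∃ v : I → V, (v : Germ (U : Filter I) V) = q.α (Finsupp.single x 1) :=
    fun x => Quotient.exists_rep _
  choose b hb using hb
  choose v hv using hv
  refine ⟨fun i => pointOf ρ (fun y => b y i) (fun x => v x i), ?_⟩
  refine RepHom.ext_of_single_one (fun y => ?_) fun x => ?_
  · rw [← hb]
    exact congrArg (fun f : I → G => (f : Germ (U : Filter I) G))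
      (funext fun i => FreeGroup.lift_apply_of)
  · rw [← hv]
    exact congrArg (fun f : I → V => (f : Germ (U : Filter I) V))
      (funext fun i => pointOf_single_one _ _ _ _)

theorem qId_ultrapower (ρ : RightRep K G V) : qId (ultrapower ρ U) = qId ρ := by
  ext q
  constructor
  · intro h p hp
    have := h (germPoint U fun _ => p) fun i =>
      (germPoint_α_eq_zero_iff U _ _).2 (Eventually.of_forall fun _ => hp i)
    rw [germPoint_α_eq_zero_iff, eventually_const] at this
    exact this
  · intro h p hp
    obtain ⟨p, rfl⟩ := exists_eq_germPoint U p
    simp only [germPoint_α_eq_zero_iff] at hp ⊢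
    filter_upwards [eventually_all.2 hp] with i hi using h _ hi

/-- Compactness: solutions of `w ≠ 0` and of each finite subsystem of `t` combine to a solution
of `w ≠ 0` and all of `t` in an ultrapower. -/
theorem exists_ultrapower_notMem_atClosure {ι : Type*} {t : ι → FreeMod K X Y}
    {w : FreeMod K X Y} (h : ∀ s : Finset ι, w ∉ atClosure ρ (t '' s)) :
    ∃ U : Ultrafilter (Finset ι), w ∉ atClosure (ultrapower ρ U) (Set.range t) := by
  have h' : ∀ s : Finset ι, ∃ p : RepHom (freeRep K X Y) ρ,
      (∀ i ∈ s, p.α (t i) = 0) ∧ p.α w ≠ 0 := by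
    simpa [atClosure, eqnsOf, algSet] using h
  choose p hp hw using h'
  refine ⟨Ultrafilter.of atTop, fun hmem => ?_⟩
  have h0 : (germPoint (Ultrafilter.of atTop) p).α w = 0 := by
    refine hmem _ ?_
    rintro _ ⟨i, rfl⟩
    refine (germPoint_α_eq_zero_iff _ _ _).2 (Ultrafilter.of_le atTop ?_)
    filter_upwards [eventually_ge_atTop {i}] with s hs
    exact hp s i (hs (Finset.mem_singleton_self i))
  obtain ⟨s, hs⟩ := ((germPoint_α_eq_zero_iff _ _ _).1 h0).exists
  exact hw s hs

end Ultrapower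

/-! ### The sign systems -/

section Signs

open Classical in
/-- The sign function on `ℤ` with values in `K` that is `-1` exactly on `S`. -/
noncomputable def sign (K : Type*) [Field K] (S : Set ℤ) (i : ℤ) : K := if i ∈ S then -1 else 1

/-- The element `bⁱ a b⁻ⁱ` of the free group on `a`, `b`. -/
def conjGen (i : ℤ) : F₂ := FreeGroup.of 1 ^ i * FreeGroup.of 0 * FreeGroup.of 1 ^ (-i)

variable (K : Type*) [Field K]

/-- The element `bⁱ a b⁻ⁱ - ε_S(i)` of `KF₂`. -/
noncomputable def signRel (S : Set ℤ) (i : ℤ) : K[F₂] :=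
  MonoidAlgebra.of K F₂ (conjGen i) - sign K S i • 1

theorem sign_mul_self (S : Set ℤ) (i : ℤ) : sign K S i * sign K S i = 1 := by
  unfold sign
  split_ifs <;> simp

/-- Multiplication by a sign function, as an automorphism of `ℤ → K`. -/
noncomputable def signEquiv (S : Set ℤ) : (ℤ → K) ≃ₗ[K] (ℤ → K) :=
  LinearEquiv.ofInvolutive (LinearMap.mulLeft K (sign K S)) fun f => by
    ext k
    simp [← mul_assoc, sign_mul_self]

/-- Translation by one, as an automorphism of `ℤ → K`. -/
def shiftEquiv : (ℤ → K) ≃ₗ[K] (ℤ → K) :=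
  LinearEquiv.funCongrLeft K K (Equiv.addRight 1)

theorem shiftEquiv_zpow_apply (i : ℤ) (f : ℤ → K) (k : ℤ) :
    (shiftEquiv K ^ i) f k = f (k + i) := by
  induction i generalizing f with
  | zero => simp
  | succ n ih =>
    rw [zpow_add_one, LinearEquiv.mul_apply, ih]
    simp [shiftEquiv, LinearEquiv.funCongrLeft_apply, LinearMap.funLeft_apply, add_assoc]
  | pred n ih =>
    rw [zpow_sub_one, LinearEquiv.mul_apply, ih]
    change f ((Equiv.addRight (1 : ℤ)).symm _) = _
    simp [sub_eq_add_neg, add_assoc]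

/-- The (left) representation of `F₂` on `ℤ → K` in which `a` multiplies by a sign function and
`b` translates. -/
noncomputable def signRep (S : Set ℤ) : Representation K F₂ (ℤ → K) :=
  (LinearEquiv.automorphismGroup.toLinearMapMonoidHom).comp
    (FreeGroup.lift ![signEquiv K S, shiftEquiv K])

theorem signRep_conjGen_apply_zero (S : Set ℤ) (i : ℤ) (f : ℤ → K) :
    signRep K S (conjGen i) f 0 = sign K S i * f 0 := by
  have : signRep K S (conjGen i) f =
      (shiftEquiv K ^ i) (signEquiv K S ((shiftEquiv K ^ (-i)) f)) := by
    simp only [signRep, conjGen, MonoidHom.comp_apply, map_mul, map_zpow, FreeGroup.lift_apply_of]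
    rfl
  rw [this, shiftEquiv_zpow_apply]
  change sign K S (0 + i) * (shiftEquiv K ^ (-i)) f (0 + i) = _
  rw [shiftEquiv_zpow_apply]
  simp

theorem one_notMem_span_signRel (S : Set ℤ) :
    (1 : K[F₂]) ∉ Submodule.span (K[F₂])ᵐᵒᵖ (Set.range (signRel K S)) := by
  intro h
  have key : ∀ u ∈ Submodule.span (K[F₂])ᵐᵒᵖ (Set.range (signRel K S)), ∀ f : ℤ → K,
      (signRep K S).asAlgebraHom u f 0 = 0 := by
    intro u hu
    induction hu using Submodule.span_induction with
    | mem u hu =>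
      obtain ⟨i, rfl⟩ := hu
      intro f
      rw [signRel, map_sub, map_smul, map_one, Representation.asAlgebraHom_of]
      simp [signRep_conjGen_apply_zero]
    | zero => simp
    | add u v _ _ hu hv => intro f; simp [hu, hv]
    | smul r u _ hu =>
      intro f
      rw [← op_unop r, op_smul_eq_mul, map_mul]
      exact hu _
  simpa using key 1 h 1

theorem eq_of_sign_eq (h2 : (2 : K) ≠ 0) {S T : Set ℤ} (h : ∀ i, sign K S i = sign K T i) :
    S = T := by
  ext i
  have hi := h i
  have h1 : (-1 : K) ≠ 1 := fun h => h2 (by linear_combination -h)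
  unfold sign at hi
  split_ifs at hi with hS hT hT
  · simp [hS, hT]
  · exact absurd hi h1
  · exact absurd hi.symm h1
  · simp [hS, hT]

end Signs

/-! ### Closures of the sign systems -/

section Closures

variable (K : Type*) [Field K]

/-- The equation `x (bⁱ a b⁻ⁱ - ε_S(i)) = 0` in one module variable `x`. -/
noncomputable def signEqn (S : Set ℤ) (i : ℤ) : FreeMod K (Fin 1) (Fin 2) :=
  Finsupp.single 0 (signRel K S i)

theorem RepHom.α_signEqn {G V : Type*} [Group G] [AddCommGroup V] [Module K V]
    {ρ : RightRep K G V} (p : RepHom (freeRep K (Fin 1) (Fin 2)) ρ) (S : Set ℤ) (i : ℤ) :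
    p.α (signEqn K S i) = ρ (op (p.β (conjGen i))) (p.α (Finsupp.single 0 1)) -
      sign K S i • p.α (Finsupp.single 0 1) := by
  rw [signEqn, signRel, Finsupp.single_sub, map_sub, p.α_single_of, ← Finsupp.smul_single,
    map_smul]

theorem single_notMem_atClosure (S : Set ℤ) (s : Finset ℤ) :
    (Finsupp.single 0 1 : FreeMod K (Fin 1) (Fin 2)) ∉
      atClosure (bigRep K) (signEqn K S '' s) := by
  classical
  let U : FGRightIdeal K :=
    ⟨Submodule.span _ (signRel K S '' s), Submodule.fg_span (s.finite_toSet.image _)⟩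
  let v : bigModule K := Pi.single U (Submodule.Quotient.mk 1)
  let p : RepHom (freeRep K (Fin 1) (Fin 2)) (bigRep K) :=
    pointOf (bigRep K) FreeGroup.of fun _ => v
  have hβ : p.β = MonoidHom.id _ := FreeGroup.ext_hom _ _ fun y => FreeGroup.lift_apply_of
  have hα : p.α (Finsupp.single 0 1) = v := pointOf_single_one _ _ _ _
  intro h
  have h0 : p.α (Finsupp.single 0 1) = 0 := by
    refine h p ?_
    rintro _ ⟨i, hi, rfl⟩
    rw [p.α_signEqn, hβ, hα]
    -- the difference is supported at the coordinate `U`, with value the class of `signRel K S i`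
    have hv : ∀ r : (K[F₂])ᵐᵒᵖ, r • v = Pi.single U (Submodule.Quotient.mk (r • 1)) := fun r =>
      (Pi.single_smul U r _).symm
    have hc : sign K S i • v =
        Pi.single U (Submodule.Quotient.mk (sign K S i • (1 : K[F₂]))) :=
      (Pi.single_smul U (sign K S i) _).symm
    rw [bigRep, ofRightModule_apply, hv, hc, ← Pi.single_sub, ← Submodule.Quotient.mk_sub,
      Pi.single_eq_zero_iff, Submodule.Quotient.mk_eq_zero, op_smul_eq_mul, one_mul]
    exact Submodule.subset_span ⟨i, hi, rfl⟩
  rw [hα, Pi.single_eq_zero_iff, Submodule.Quotient.mk_eq_zero] at h0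
  exact one_notMem_span_signRel K S (Submodule.span_mono (Set.image_subset_range _ _) h0)

variable [Countable K]

instance : Countable K[F₂] := MonoidAlgebra.coeff_injective.countable

instance : Countable (FGRightIdeal K) := by
  choose g hg using fun U : FGRightIdeal K => U.2
  refine Function.Injective.countable (f := g) fun U W h => Subtype.ext ?_
  rw [← hg U, ← hg W, h]

instance : Countable (F₂ →* F₂) :=
  Function.Injective.countable (f := fun φ (i : Fin 2) => φ (FreeGroup.of i)) fun _ _ h =>
    FreeGroup.ext_hom _ _ fun i => congrFun h i

instance (U : FGRightIdeal K) : Countable (K[F₂] ⧸ U.1) :=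
  (Submodule.Quotient.mk_surjective U.1).countable

theorem exists_single_mem_atClosure (h2 : (2 : K) ≠ 0) :
    ∃ S : Set ℤ, (Finsupp.single 0 1 : FreeMod K (Fin 1) (Fin 2)) ∈
      atClosure (bigRep K) (Set.range (signEqn K S)) := by
  by_contra! hne
  have h : ∀ S : Set ℤ, ∃ c : (F₂ →* F₂) × (Σ U : FGRightIdeal K, K[F₂] ⧸ U.1),
      c.2.2 ≠ 0 ∧ ∀ i, op (MonoidAlgebra.of K F₂ (c.1 (conjGen i))) • c.2.2 =
        sign K S i • c.2.2 := by
    intro S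
    have hS := hne S
    simp only [atClosure, eqnsOf, Set.mem_ofPred_eq, not_forall] at hS
    obtain ⟨p, hp, hx⟩ := hS
    obtain ⟨U, hU⟩ := Function.ne_iff.1 hx
    refine ⟨(p.β, ⟨U, p.α (Finsupp.single 0 1) U⟩), hU, fun i => ?_⟩
    have := hp _ ⟨i, rfl⟩
    rw [p.α_signEqn, sub_eq_zero] at this
    exact congrFun this U
  choose c hc0 hc using h
  have hinj : Function.Injective c := fun S T hST => by
    refine eq_of_sign_eq K h2 fun i => ?_
    have hT := hc T i
    rw [← hST, hc S i] at hT
    exact smul_left_injective K (hc0 S) hT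
  obtain ⟨f, hf⟩ := hinj.countable
  exact Function.cantor_injective _ (Nat.cast_injective (R := ℤ) |>.comp hf)

end Closures

end ActionType

theorem mainTheorem3 (K : Type*) [Field K] [Countable K] [Infinite K] (hK : ringChar K ≠ 2) :
    ¬ ActionType.LogicallyNoetherian (ActionType.bigRep K) ∧
    ∃ (I : Type) (U : Ultrafilter I),
      ¬ ActionType.GeomEquiv (ActionType.ultrapower (ActionType.bigRep K) U)
          (ActionType.bigRep K) ∧
      ActionType.qId (ActionType.ultrapower (ActionType.bigRep K) U) =
        ActionType.qId (ActionType.bigRep K) := by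
  obtain ⟨S, hS⟩ := ActionType.exists_single_mem_atClosure K (Ring.two_ne_zero hK)
  constructor
  · intro h
    have hT := h 1 2 _ _ hS
    rw [← Set.image_univ, Set.exists_subset_image_finite_and] at hT
    obtain ⟨s, -, hs, hmem⟩ := hT
    obtain ⟨s, rfl⟩ := hs.exists_finset_coe
    exact ActionType.single_notMem_atClosure K S _ hmem
  · obtain ⟨U, hU⟩ := ActionType.exists_ultrapower_notMem_atClosure
      (ActionType.single_notMem_atClosure K S)
    exact ⟨_, U, fun h => hU (h 1 2 _ ▸ hS), ActionType.qId_ultrapower U _⟩
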